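/- Fix integers $A,B,D\ge 0$. There are constants $C,k$, depending only on $A,B,D$, such that the following holds for every $n\ge 2$, every $n$-point metric space $\mathcal M=([n],\mathsf d)$ whose aspect ratio (largest distance divided by smallest nonzero distance) is at most $n^A$, and every real $c>6$. There is a randomized dynamic streaming algorithm $\mathcal A$ (which may depend on $\mathcal M$, $c$ and $A,B,D$) with the following two properties. (1) For every stream of updates $\mathrm{Add}(i)$, $\mathrm{Remove}(i)$, $i\in[n]$, whose final frequency vector $x\in\mathbb Z^n$ satisfies $0\le x_i\le n^B$ for all $i$ (intermediate frequency vectors are arbitrary), with probability at least $1-n^{-D}$ over its random bits $\mathcal A$ outputs a $c$-approximation of $\operatorname{diam}_{\mathcal M}(x)=\max\{\mathsf d(i,j):x_i,x_j>0\}$ (with $\max\emptyset=0$), that is, a number $\eta\in\mathbb R$ with $$\operatorname{diam}_{\mathcal M}(x)/c<\eta\le \operatorname{diam}_{\mathcal M}(x)$$ if $\operatorname{diam}_{\mathcal M}(x)>0$, and $\eta=0$ if $\operatorname{diam}_{\mathcal M}(x)=0$. (2) $\mathcal A$ uses at most $$C\, n^{1/\lfloor (c-2)/4\rfloor}\,(\log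 n)^k=\tilde O\big(n^{1/\lfloor (c-2)/4\rfloor}\big)$$ bits of space. Here a randomized dynamic streaming algorithm is a Turing machine with a one-way read-only input tape holding the stream, a two-way working tape over $\{0,1\}$ (initially empty), and a two-way read-only random tape holding finitely many uniform random bits $\rho\in\{0,1\}^r$. Each update is processed starting from a fixed start state with the heads on the first cells, until a fixed end state is reached. The output is a function of the final working tape and the random tape. Its space is $\log_2|\mathcal W|$, where $\mathcal W$ is the (finite) set of all working tapes that can result, for any random tape, from a stream whose final frequency vector lies in $\{-n^B,\dots,n^B\}^n$. -/

import Mathlib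

namespace DynStream

/-! ### Dynamic streams -/

/-- One update of a dynamic stream over the index set `X`. -/
inductive Update (X : Type) where
  | add (i : X) : Update X
  | remove (i : X) : Update X

/-- The change of the frequency vector caused by one update: `+ e_i` or `- e_i`. -/
def Update.vec {X : Type} [DecidableEq X] : Update X → (X → ℤ)
  | .add i => Pi.single i 1
  | .remove i => Pi.single i (-1)

/-- The frequency vector of a stream (starting from the zero vector). -/
def freq {X : Type} [DecidableEq X] (σ : List (Update X)) : X → ℤ :=
  (σ.map Update.vec).sum

/-! ### Turing machines that process one update -/

/-- Moves of a tape head. -/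
inductive Move where
  | left
  | stay
  | right

/-- Head positions are natural numbers; moving left from the first cell has no effect. -/
def Move.apply : Move → ℕ → ℕ
  | .left, p => p - 1
  | .stay, p => p
  | .right, p => p + 1

/-- A Turing machine with a read-only one-way input tape (whose cells are stream updates), a
two-way read/write working tape and a two-way read-only random tape, both over `{0,1}` and the
blank symbol `none`. In one step the machine sees its state, the input cell of the current round
and the two scanned tape cells; it changes its state, writes the working cell and moves the two
heads. The input head moves to the next update exactly at the beginning of a round. -/
structure Machine (X : Type) where
  /-- the state space -/
  State : Type
  /-- there are finitely many states -/
  finite_State : Finite State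
  /-- the state in which the processing of an update starts -/
  startState : State
  /-- the state in which the processing of an update is complete -/
  endState : State
  /-- the transition function: state, current update, scanned working cell, scanned random cell
  are sent to the new state, the written working symbol, the move of the working head and the
  move of the random head -/
  trans : State → Update X → Option Bool → Option Bool → State × Option Bool × Move × Move

/-- A tape that holds the word `w` in its first cells and is blank elsewhere. -/
def tapeOf (w : List Bool) : ℕ → Option Bool := fun j => w[j]?

/-- An instantaneous description of a machine during one round. -/
structure Cfg {X : Type} (M : Machine X) where
  /-- current state -/
  state : M.State
  /-- contents of the working tape -/
  work : ℕ → Option Bool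
  /-- position of the working head -/
  workHead : ℕ
  /-- position of the random head -/
  randHead : ℕ

open Classical in
/-- One step while processing the update `a` with random tape contents `ρ`; the machine halts
when it is in the end state. -/
noncomputable def Machine.step {X : Type} (M : Machine X) (ρ : List Bool) (a : Update X)
    (s : Cfg M) : Option (Cfg M) :=
  if s.state = M.endState then none
  else
    let t := M.trans s.state a (s.work s.workHead) (tapeOf ρ s.randHead)
    some
      { state := t.1
        work := Function.update s.work s.workHead t.2.1
        workHead := t.2.2.1.apply s.workHead
        randHead := t.2.2.2.apply s.randHead }

/-- The configuration at the beginning of a round: start state, working tape `w`, heads on the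
first cells. -/
def Machine.init {X : Type} (M : Machine X) (w : List Bool) : Cfg M where
  state := M.startState
  work := tapeOf w
  workHead := 0
  randHead := 0

/-- `M.Round ρ a w w'`: started on working tape `w`, the machine processes the update `a`,
reaches the end state, and then the working tape holds the word `w'`. -/
def Machine.Round {X : Type} (M : Machine X) (ρ : List Bool) (a : Update X)
    (w w' : List Bool) : Prop :=
  ∃ s : Cfg M, StateTransition.Reaches (M.step ρ a) (M.init w) s ∧
    s.state = M.endState ∧ s.work = tapeOf w'

/-- `M.Run ρ w σ w'`: processing the stream `σ` update by update with random tape `ρ` changes the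
working tape from `w` to `w'`. -/
def Machine.Run {X : Type} (M : Machine X) (ρ : List Bool) :
    List Bool → List (Update X) → List Bool → Prop
  | w, [], w' => w' = w
  | w, a :: σ, w' => ∃ u, M.Round ρ a w u ∧ M.Run ρ u σ w'

/-! ### Randomized streaming algorithms -/

/-- A randomized streaming algorithm with real-valued output: a machine, the number `r` of random
bits, and an output function of the final working tape and the random tape. On every stream and
every random tape, the processing of each update terminates with a word on the working tape. -/
structure StreamingAlgorithm (X : Type) extends Machine X where
  /-- randomness complexity: the length of the random tape -/
  r : ℕ
  /-- the output function -/
  dec : List Bool → (Fin r → Bool) → ℝ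
  halts : ∀ (ρ : Fin r → Bool) (σ : List (Update X)) (w : List Bool),
    toMachine.Run (List.ofFn ρ) [] σ w →
      ∀ a : Update X, ∃ w', toMachine.Round (List.ofFn ρ) a w w'

/-- `𝒜.FinalTape ρ σ w`: on the stream `σ`, started with the empty working tape and with random
tape `ρ`, the final working tape is `w`. -/
def StreamingAlgorithm.FinalTape {X : Type} (𝒜 : StreamingAlgorithm X) (ρ : Fin 𝒜.r → Bool)
    (σ : List (Update X)) (w : List Bool) : Prop :=
  𝒜.toMachine.Run (List.ofFn ρ) [] σ w

/-- The probability, over `r` independent uniform random bits, of the event `E`. -/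
noncomputable def bitProb {r : ℕ} (E : Set (Fin r → Bool)) : ℝ :=
  (E.ncard : ℝ) / 2 ^ r

/-- The probability that the output of the algorithm on the stream `σ` satisfies `P`. -/
noncomputable def StreamingAlgorithm.outputProb {X : Type} (𝒜 : StreamingAlgorithm X)
    (σ : List (Update X)) (P : ℝ → Prop) : ℝ :=
  bitProb {ρ : Fin 𝒜.r → Bool | ∃ w, 𝒜.FinalTape ρ σ w ∧ P (𝒜.dec w ρ)}

/-- The working tapes that can result from a stream whose final frequency vector has entries
of magnitude at most `m` (and arbitrary intermediate frequency vectors), over all random tapes. -/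
def StreamingAlgorithm.finalTapes {X : Type} [DecidableEq X] (𝒜 : StreamingAlgorithm X)
    (m : ℕ) : Set (List Bool) :=
  {w | ∃ (ρ : Fin 𝒜.r → Bool) (σ : List (Update X)),
    (∀ i, |freq σ i| ≤ (m : ℤ)) ∧ 𝒜.FinalTape ρ σ w}

/-- The algorithm uses at most `b` bits of space on streams whose final frequency vector has
entries of magnitude at most `m`: there are finitely many possible final working tapes, and the
binary logarithm of their number is at most `b`. -/
def StreamingAlgorithm.SpaceLE {X : Type} [DecidableEq X] (𝒜 : StreamingAlgorithm X)
    (m : ℕ) (b : ℝ) : Prop :=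
  (𝒜.finalTapes m).Finite ∧ Real.logb 2 ((𝒜.finalTapes m).ncard : ℝ) ≤ b

/-! ### The diameter problem -/

/-- The diameter of the multiset encoded by `x`: the maximum of `dist i j` over `x i, x j > 0`
(zero if there is no such pair). -/
noncomputable def diam {X : Type} [MetricSpace X] (x : X → ℤ) : ℝ :=
  Metric.diam {i : X | 0 < x i}

/-- `η` is a `c`-approximation of `D ≥ 0`: `D / c < η ≤ D`. For `D = 0`, where the strict
inequality cannot hold, this means `η = 0`. -/
def IsApprox (c D η : ℝ) : Prop :=
  (D / c < η ∧ η ≤ D) ∨ (D = 0 ∧ η = 0)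

/-- The ratio of the largest to the smallest distance between distinct points is at most `Δ`. -/
def AspectRatioLE (X : Type) [MetricSpace X] (Δ : ℝ) : Prop :=
  ∀ i j k l : X, i ≠ j → k ≠ l → dist i j ≤ Δ * dist k l

end DynStream

namespace DynStream

/-! The diameter is located among geometric scales r = ρ q^s. At each scale, ball carving yields
about n^{1/t} log n partitions into clusters of diameter at most (4t - 2) r such that every r-ball
lies in a cluster of one of them (`exists_sparse_cover`). If the support has diameter at most r,
some partition has it in a single cluster; conversely, lying in a single cluster bounds the diameter
by (4t - 2) r. The first scale that passes thus determines the diameter up to the factor (4t - 2) q.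

For nonnegative weights, equality M₀M₂ = M₁² in Cauchy-Schwarz for the moments of the labels holds
exactly when the label is constant on the support (`moments_eq_iff`). So three linear counters
modulo a large N per partition decide the test without randomness, and they depend only on the final
frequency vector. Transition functions are unrestricted, so any finite automaton can be run by a
machine (`exists_streamingAlgorithm_of_automaton`).

With t ≤ ⌊(c - 2)/4⌋ and q = 1 + 1/t the factor stays below c. -/

/-! ### Implementing a finite automaton by a machine -/

/-- A machine that reads the first `l + 1` cells of the working tape into its state, and then
replaces their contents by the word `F g a`, where `g` is what it has read and `a` is the current
update, writing from right to left. -/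
def rewriteMachine {X : Type} (l : ℕ)
    (F : (Fin (l + 1) → Option Bool) → Update X → (Fin (l + 1) → Bool)) : Machine X where
  State := Option (Bool × Fin (l + 1) × (Fin (l + 1) → Option Bool))
  finite_State := inferInstance
  startState := some (false, 0, fun _ => none)
  endState := none
  trans q a s _ :=
    match q with
    | none => (none, s, .stay, .stay)
    | some (false, j, g) =>
        if j = Fin.last l then
          (some (true, j, fun i => some (F (Function.update g j s) a i)), s, .stay, .stay)
        else
          (some (false, j + 1, Function.update g j s), s, .right, .stay)
    | some (true, j, g) =>
        if j = 0 then (none, g j, .stay, .stay) else (some (true, j - 1, g), g j, .left, .stay)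

variable {X : Type} {l : ℕ} {F : (Fin (l + 1) → Option Bool) → Update X → (Fin (l + 1) → Bool)}

theorem tapeOf_injective : Function.Injective tapeOf := by
  intro u v h
  exact List.ext_getElem? fun i => congrFun h i

/-- Different outcomes of a round have the same working tape. -/
theorem Machine.Round.unique {M : Machine X} {ρ : List Bool} {a : Update X} {w u v : List Bool}
    (hu : M.Round ρ a w u) (hv : M.Round ρ a w v) : u = v := by
  obtain ⟨s, hs, hse, hsw⟩ := hu
  obtain ⟨s', hs', hse', hsw'⟩ := hv
  -- The step function is deterministic, so of two reachable configurations one reaches the other; a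
  -- halted one reaches only itself.
  have stuck : ∀ {x y : Cfg M}, x.state = M.endState →
      StateTransition.Reaches (M.step ρ a) x y → y = x := by
    intro x y hx hxy
    rcases hxy.cases_head with h | ⟨z, hz, -⟩
    · exact h.symm
    · simp [Machine.step, hx] at hz
  have hss : s = s' := by
    rcases StateTransition.reaches_total hs hs' with h | h
    · exact (stuck hse h).symm
    · exact stuck hse' h
  subst hss
  exact tapeOf_injective (hsw.symm.trans hsw')

theorem rewriteMachine_reads (ρ : List Bool) (a : Update X) (w : List Bool) (j : ℕ)
    (hj : j < l + 1) :
    StateTransition.Reaches ((rewriteMachine l F).step ρ a) ((rewriteMachine l F).init w)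
      ⟨some (false, ⟨j, hj⟩, fun i => if (i : ℕ) < j then w[(i : ℕ)]? else none),
        tapeOf w, j, 0⟩ := by
  induction j with
  | zero =>
    have : (fun i : Fin (l + 1) => if (i : ℕ) < 0 then w[(i : ℕ)]? else none) = fun _ => none := by
      simp
    rw [this]
    exact Relation.ReflTransGen.refl
  | succ j ih =>
    refine (ih (by omega)).tail ?_
    have h1 : (⟨j, by omega⟩ : Fin (l + 1)) ≠ Fin.last l := by
      intro h; have := congrArg Fin.val h; simp at this; omega
    have h2 : (⟨j, by omega⟩ : Fin (l + 1)) + 1 = ⟨j + 1, hj⟩ := by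
      apply Fin.ext
      rw [Fin.val_add_one_of_lt (lt_of_le_of_ne (Fin.le_last _) h1)]
    have h3 : Function.update (fun i : Fin (l + 1) => if (i : ℕ) < j then w[(i : ℕ)]? else none)
        ⟨j, by omega⟩ (tapeOf w j) =
        fun i : Fin (l + 1) => if (i : ℕ) < j + 1 then w[(i : ℕ)]? else none := by
      funext i
      by_cases hi : i = ⟨j, by omega⟩
      · subst hi; simp [tapeOf]
      · have : (i : ℕ) ≠ j := fun h => hi (Fin.ext h)
        rw [Function.update_of_ne hi]
        by_cases h : (i : ℕ) < j
        · simp [h, Nat.lt_succ_of_lt h]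
        · rw [if_neg h, if_neg (by omega)]
    simp only [Machine.step, rewriteMachine, reduceCtorEq, if_false, h1, h2, h3, Move.apply,
      Function.update_eq_self]
    rfl

theorem rewriteMachine_writes (ρ : List Bool) (a : Update X) (T : ℕ → Option Bool)
    (g : Fin (l + 1) → Option Bool) (j : ℕ) (hj : j < l + 1) :
    StateTransition.Reaches ((rewriteMachine l F).step ρ a)
      ⟨some (true, ⟨j, hj⟩, g), T, j, 0⟩
      ⟨none, fun i => if h : i ≤ j then g ⟨i, by omega⟩ else T i, 0, 0⟩ := by
  induction j generalizing T with
  | zero =>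
    refine Relation.ReflTransGen.single ?_
    have h : Function.update T 0 (g 0) =
        fun i => if h : i ≤ 0 then g ⟨i, by omega⟩ else T i := by
      funext i
      by_cases hi : i = 0
      · subst hi; simp
      · simp [hi]
    simp only [Machine.step, rewriteMachine, reduceCtorEq, if_false, Fin.mk_zero, if_true,
      Move.apply, h]
    rfl
  | succ j ih =>
    refine Relation.ReflTransGen.head ?_ (?_ : StateTransition.Reaches _
      ⟨some (true, ⟨j, by omega⟩, g), Function.update T (j + 1) (g ⟨j + 1, hj⟩), j, 0⟩ _)
    · have h1 : (⟨j + 1, hj⟩ : Fin (l + 1)) ≠ 0 := by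
        intro h; simpa using congrArg Fin.val h
      have h2 : (⟨j + 1, hj⟩ : Fin (l + 1)) - 1 = ⟨j, by omega⟩ := by
        apply Fin.ext
        rw [Fin.val_sub_one_of_ne_zero h1]; simp
      simp only [Machine.step, rewriteMachine, reduceCtorEq, if_false, h1, h2, Move.apply,
        Nat.add_sub_cancel]
      rfl
    · convert ih (Function.update T (j + 1) (g ⟨j + 1, hj⟩)) (by omega) using 2
      funext i
      rcases lt_trichotomy i (j + 1) with h | h | h
      · simp [h.le, Nat.lt_succ_iff.mp h]
      · subst h; simp
      · simp [show ¬ i ≤ j + 1 by omega, show ¬ i ≤ j by omega, show i ≠ j + 1 by omega]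

/-- The length bound ensures that no cell of the old word survives beyond the rewritten ones. -/
theorem rewriteMachine_round (ρ : List Bool) (a : Update X) {w : List Bool}
    (hw : w.length ≤ l + 1) :
    (rewriteMachine l F).Round ρ a w (List.ofFn (F (fun i => w[(i : ℕ)]?) a)) := by
  refine ⟨_, ((rewriteMachine_reads (F := F) ρ a w l (Nat.lt_succ_self l)).tail ?_).trans
    (rewriteMachine_writes ρ a (tapeOf w) (fun i => some (F (fun i => w[(i : ℕ)]?) a i)) l
      (Nat.lt_succ_self l)), rfl, ?_⟩
  · have h1 : (⟨l, by omega⟩ : Fin (l + 1)) = Fin.last l := rfl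
    have h2 : Function.update (fun i : Fin (l + 1) => if (i : ℕ) < l then w[(i : ℕ)]? else none)
        (Fin.last l) (tapeOf w l) = fun i : Fin (l + 1) => w[(i : ℕ)]? := by
      funext i
      by_cases hi : i = Fin.last l
      · subst hi; simp [tapeOf]
      · have : (i : ℕ) < l := by
          have := lt_of_le_of_ne (Fin.le_last i) hi
          simpa [Fin.lt_def] using this
        rw [Function.update_of_ne hi, if_pos this]
    simp only [Machine.step, rewriteMachine, reduceCtorEq, if_false, if_true, h1, h2, Move.apply,
      Function.update_eq_self]
    rfl
  · funext i
    by_cases hi : i ≤ l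
    · simp only [tapeOf, hi, dite_true, List.getElem?_ofFn, Nat.lt_succ_of_le hi]
    · simp only [tapeOf, hi, dite_false]
      rw [List.getElem?_eq_none (by omega), List.getElem?_eq_none (by simp; omega)]

/-- Every finite automaton that reads the updates of a stream is implemented by a deterministic
streaming algorithm, whose space is the logarithm of the number of memory states (and of the empty
tape). -/
theorem exists_streamingAlgorithm_of_automaton [DecidableEq X] {S : Type} [Fintype S] (m₀ : S)
    (f : S → Update X → S) (out : S → ℝ) :
    ∃ 𝒜 : StreamingAlgorithm X,
      (∀ (σ : List (Update X)) (P : ℝ → Prop), P (out (σ.foldl f m₀)) → 𝒜.outputProb σ P = 1) ∧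
      ∀ m : ℕ, 𝒜.SpaceLE m (Real.logb 2 (Fintype.card S + 1)) := by
  classical
  obtain ⟨l, ⟨enc⟩⟩ : ∃ l : ℕ, Nonempty (S ↪ (Fin (l + 1) → Bool)) := by
    refine ⟨Nat.clog 2 (Fintype.card S), Function.Embedding.nonempty_of_card_le ?_⟩
    rw [Fintype.card_fun, Fintype.card_bool, Fintype.card_fin]
    exact (Nat.le_pow_clog one_lt_two _).trans (Nat.pow_le_pow_right two_pos (Nat.le_succ _))
  -- The default value matters: the empty initial tape reads as all blanks, which is no code word
  -- since there is at least one cell, and so it stands for `m₀`.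
  let decode : (Fin (l + 1) → Option Bool) → S := fun g =>
    if h : ∃ m, g = fun i => some (enc m i) then h.choose else m₀
  have decode_enc : ∀ m, decode (fun i => some (enc m i)) = m := by
    intro m
    have h : ∃ m', (fun i => some (enc m i)) = fun i => some (enc m' i) := ⟨m, rfl⟩
    have h' := h.choose_spec
    have : decode (fun i => some (enc m i)) = h.choose := dif_pos h
    rw [this]
    refine enc.injective (funext fun i => ?_)
    exact (Option.some.inj (congrFun h' i)).symm
  have decode_none : decode (fun _ => none) = m₀ := by
    refine dif_neg ?_
    rintro ⟨m, hm⟩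
    exact absurd (congrFun hm 0) (by simp)
  have read_enc : ∀ m, (fun i : Fin (l + 1) => (List.ofFn (enc m))[(i : ℕ)]?) =
      fun i => some (enc m i) := by
    intro m
    funext i
    rw [List.getElem?_ofFn, dif_pos i.isLt]
  let M := rewriteMachine l (fun g a => enc (f (decode g) a))
  let Codes : S → List Bool → Prop := fun m w => (w = [] ∧ m = m₀) ∨ w = List.ofFn (enc m)
  have hround : ∀ ρ a m w, Codes m w → M.Round ρ a w (List.ofFn (enc (f m a))) := by
    rintro ρ a m w (⟨rfl, rfl⟩ | rfl)
    · have := rewriteMachine_round (F := fun g a => enc (f (decode g) a)) ρ a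
        (w := []) (by simp)
      simpa [decode_none] using this
    · have := rewriteMachine_round (F := fun g a => enc (f (decode g) a)) ρ a
        (w := List.ofFn (enc m)) (by simp)
      rwa [read_enc, decode_enc] at this
  have hrun : ∀ ρ σ m w w', Codes m w → M.Run ρ w σ w' → Codes (σ.foldl f m) w' := by
    intro ρ σ
    induction σ with
    | nil => rintro m w w' h rfl; exact h
    | cons a σ ih =>
      rintro m w w' h ⟨u, hu, hur⟩
      exact ih (f m a) u w' (Or.inr (hu.unique (hround ρ a m w h))) hur
  have hrun' : ∀ ρ σ m w, Codes m w → ∃ w', M.Run ρ w σ w' := by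
    intro ρ σ
    induction σ with
    | nil => intro m w _; exact ⟨w, rfl⟩
    | cons a σ ih =>
      intro m w h
      obtain ⟨w', hw'⟩ := ih (f m a) _ (Or.inr rfl)
      exact ⟨w', _, hround ρ a m w h, hw'⟩
  have h₀ : Codes m₀ [] := Or.inl ⟨rfl, rfl⟩
  let 𝒜 : StreamingAlgorithm X :=
    { M with
      r := 0
      dec := fun w _ => out (decode fun i => w[(i : ℕ)]?)
      halts := fun ρ σ w h a => ⟨_, hround _ a _ w (hrun _ σ _ _ w h₀ h)⟩ }
  refine ⟨𝒜, ?_, ?_⟩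
  · intro σ P hP
    have : {ρ : Fin 𝒜.r → Bool | ∃ w, 𝒜.FinalTape ρ σ w ∧ P (𝒜.dec w ρ)} = Set.univ := by
      refine Set.eq_univ_of_forall fun ρ => ?_
      obtain ⟨w, hw⟩ := hrun' (List.ofFn ρ) σ m₀ [] h₀
      refine ⟨w, hw, ?_⟩
      have hdec : (decode fun i => w[(i : ℕ)]?) = σ.foldl f m₀ := by
        rcases hrun _ σ _ _ w h₀ hw with ⟨rfl, h⟩ | rfl
        · simpa [decode_none] using h.symm
        · rw [read_enc, decode_enc]
      change P (out (decode fun i => w[(i : ℕ)]?))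
      rwa [hdec]
    rw [StreamingAlgorithm.outputProb, this, bitProb]
    have hr : 𝒜.r = 0 := rfl
    simp [Set.ncard_univ, hr]
  · intro m
    have hsub : 𝒜.finalTapes m ⊆
        ↑(insert [] (Finset.univ.image fun m : S => List.ofFn (enc m))) := by
      rintro w ⟨ρ, σ, -, hw⟩
      rcases hrun _ σ _ _ w h₀ hw with ⟨rfl, -⟩ | rfl
      · exact Finset.mem_insert_self _ _
      · exact Finset.mem_insert_of_mem (Finset.mem_image_of_mem _ (Finset.mem_univ _))
    have hfin : (𝒜.finalTapes m).Finite := (Finset.finite_toSet _).subset hsub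
    have hcard : (𝒜.finalTapes m).ncard ≤ Fintype.card S + 1 := by
      refine (Set.ncard_le_ncard hsub (Finset.finite_toSet _)).trans ?_
      rw [Set.ncard_coe_finset]
      refine (Finset.card_insert_le _ _).trans (Nat.succ_le_succ ?_)
      exact Finset.card_image_le
    have hpos : 0 < (𝒜.finalTapes m).ncard := by
      rw [Set.ncard_pos hfin]
      exact ⟨[], fun _ => false, [], by simp [freq], rfl⟩
    refine ⟨hfin, Real.logb_le_logb_of_le one_lt_two (by exact_mod_cast hpos) ?_⟩
    exact_mod_cast hcard

/-! ### Sparse covers by partitions -/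

/-- In a finite metric space with at most `b ^ t` points, ball growing around `u` finds a radius
at which the number of points of `U` grows by at most the factor `b`. -/
theorem exists_slow_growth {X : Type*} [PseudoMetricSpace X] {U : Finset X} {u : X}
    (hu : u ∈ U) {t : ℕ} {b : ℝ} (hb : 0 ≤ b) (hU : (U.card : ℝ) ≤ b ^ t)
    (ht : 1 ≤ t) (ρ : ℝ) :
    ∃ j < t, ((U.filter fun i => dist u i ≤ 2 * ρ * (j + 1)).card : ℝ) ≤
      b * (U.filter fun i => dist u i ≤ 2 * ρ * j).card := by
  by_contra! h
  -- The ball of radius 0 contains `u`; if each of the `t` enlargements multiplied the count by more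
  -- than `b`, it would exceed `b ^ t`.
  have key : ∀ j < t, b ^ (j + 1) < ((U.filter fun i => dist u i ≤ 2 * ρ * (j + 1)).card : ℝ) := by
    intro j
    induction j with
    | zero =>
      intro hj
      refine lt_of_le_of_lt ?_ (h 0 hj)
      have : 0 < (U.filter fun i => dist u i ≤ 2 * ρ * (0 : ℕ)).card :=
        Finset.card_pos.mpr ⟨u, by simp [hu]⟩
      rw [zero_add, pow_one]
      exact le_mul_of_one_le_right hb (by exact_mod_cast Nat.one_le_iff_ne_zero.mpr this.ne')
    | succ j ih =>
      intro hj
      refine lt_of_le_of_lt ?_ (h (j + 1) hj)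
      rw [pow_succ']
      have := (ih (by omega)).le
      push_cast
      gcongr
  obtain ⟨t, rfl⟩ := Nat.exists_eq_succ_of_ne_zero (by omega : t ≠ 0)
  have h1 := key t (by omega)
  have h2 : ((U.filter fun i => dist u i ≤ 2 * ρ * (t + 1)).card : ℝ) ≤ U.card := by
    exact_mod_cast Finset.card_filter_le _ _
  exact absurd (h1.trans_le (h2.trans hU)) (lt_irrefl _)

/-- Ball carving: a partition into clusters of diameter at most `(4t - 2)ρ`, given as the fibres of
a labelling, such that for a `1 / b` fraction of the points of `U` the ball of radius `ρ` is
contained in a cluster. -/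
theorem exists_padded_labelling {X : Type*} [Fintype X] [MetricSpace X] {t : ℕ} (ht : 1 ≤ t)
    {b : ℝ} (hb : 0 ≤ b) (hX : (Fintype.card X : ℝ) ≤ b ^ t) {ρ : ℝ} (hρ : 0 ≤ ρ)
    (U : Finset X) :
    ∃ (κ : X → ℕ) (V : Finset X),
      (∀ i j, κ i = κ j → dist i j ≤ (4 * t - 2) * ρ) ∧
      V ⊆ U ∧ (U.card : ℝ) ≤ b * V.card ∧ ∀ i ∈ V, ∀ j, dist i j ≤ ρ → κ i = κ j := by
  classical
  have ht' : (1 : ℝ) ≤ t := by exact_mod_cast ht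
  induction U using Finset.strongInduction with
  | H U ih =>
  rcases U.eq_empty_or_nonempty with rfl | ⟨u, hu⟩
  · refine ⟨fun i => Fintype.equivFin X i, ∅, fun i j h => ?_, by simp, by simp, by simp⟩
    have : i = j := (Fintype.equivFin X).injective (Fin.ext h)
    subst this
    rw [dist_self]
    exact mul_nonneg (by linarith) hρ
  have hUX : (U.card : ℝ) ≤ b ^ t := le_trans (by exact_mod_cast Finset.card_le_univ U) hX
  obtain ⟨j, hjt, hj⟩ := exists_slow_growth hu hb hUX ht ρ
  have hjt' : (j : ℝ) + 1 ≤ t := by exact_mod_cast hjt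
  set near := U.filter fun i => dist u i ≤ 2 * ρ * j with hnear
  set far := U.filter fun i => ¬ dist u i ≤ 2 * ρ * (j + 1) with hfar
  obtain ⟨κ, V, hκ, hVU, hcard, hpad⟩ := ih far (by
    refine (Finset.ssubset_iff_of_subset (Finset.filter_subset _ _)).mpr ⟨u, hu, ?_⟩
    have : (0 : ℝ) ≤ 2 * ρ * (j + 1) := by positivity
    simp [this])
  -- The cut is midway between the radii `2jρ` and `2(j + 1)ρ`, so the `ρ`-balls of points of `near`
  -- lie inside it and those of points of `far` outside. The shell in between is given up; slow
  -- growth bounds this loss. As `j ≤ t - 1`, the new cluster has diameter at most `(4t - 2)ρ`.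
  refine ⟨fun i => if dist u i ≤ (2 * j + 1) * ρ then 0 else κ i + 1, near ∪ V, ?_, ?_, ?_, ?_⟩
  · intro x y hxy
    by_cases hx : dist u x ≤ (2 * j + 1) * ρ <;> by_cases hy : dist u y ≤ (2 * j + 1) * ρ
    · have := dist_triangle_left x y u
      nlinarith
    · simp [hx, hy] at hxy
    · simp [hx, hy] at hxy
    · simp only [hx, hy, if_false] at hxy
      exact hκ x y (by omega)
  · exact Finset.union_subset (Finset.filter_subset _ _)
      (hVU.trans (Finset.filter_subset _ _))
  · have hdisj : Disjoint near V := by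
      refine Finset.disjoint_left.mpr fun i hi hiV => ?_
      have h1 := (Finset.mem_filter.mp hi).2
      have h2 := (Finset.mem_filter.mp (hVU hiV)).2
      exact h2 (by nlinarith)
    rw [Finset.card_union_of_disjoint hdisj,
      ← Finset.card_filter_add_card_filter_not (s := U) (fun i => dist u i ≤ 2 * ρ * (j + 1))]
    push_cast
    linarith
  · intro x hx y hxy
    rcases Finset.mem_union.mp hx with hx | hx
    · have h1 := (Finset.mem_filter.mp hx).2
      have h2 := dist_triangle u x y
      have hx' : dist u x ≤ (2 * j + 1) * ρ := by linarith
      have hy' : dist u y ≤ (2 * j + 1) * ρ := by linarith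
      simp [hx', hy']
    · have h1 := (Finset.mem_filter.mp (hVU hx)).2
      have h2 := dist_triangle u y x
      rw [dist_comm y x] at h2
      have hx' : ¬ dist u x ≤ (2 * j + 1) * ρ := fun h => h1 (by linarith)
      have hy' : ¬ dist u y ≤ (2 * j + 1) * ρ := fun h => h1 (by linarith)
      simp [hx', hy', hpad x hx y hxy]

/-- The labels of a labelling of a finite type can be chosen smaller than the number of points. -/
theorem exists_labelling_lt_card {X : Type*} [Fintype X] (κ : X → ℕ) :
    ∃ κ' : X → ℕ, (∀ i, κ' i < Fintype.card X) ∧ ∀ i j, κ' i = κ' j ↔ κ i = κ j := by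
  have key : ∀ i, ∃ k, κ k = κ i := fun i => ⟨i, rfl⟩
  -- Each fibre is labelled by the index of a representative.
  have hr : ∃ r : X → X, (∀ i, κ (r i) = κ i) ∧ ∀ i j, κ i = κ j → r i = r j := by
    rcases isEmpty_or_nonempty X with h | h
    · exact ⟨id, fun _ => rfl, fun i => h.elim i⟩
    · exact ⟨fun i => Function.invFun κ (κ i), fun i => Function.invFun_eq (key i),
        fun i j hij => by simp only [hij]⟩
  obtain ⟨r, hr, hr'⟩ := hr
  refine ⟨fun i => Fintype.equivFin X (r i), fun i => Fin.isLt _, fun i j => ⟨fun h => ?_, fun h => ?_⟩⟩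
  · have := (Fintype.equivFin X).injective (Fin.ext h)
    rw [← hr i, ← hr j, this]
  · simp only [hr' i j h]

/-- A sparse cover: about `b log n` partitions into clusters of diameter at most `(4t - 2)ρ` such
that every ball of radius `ρ` is contained in a cluster of one of them. -/
theorem exists_sparse_cover {X : Type*} [Fintype X] [MetricSpace X] {t : ℕ} (ht : 1 ≤ t)
    {b : ℝ} (hb : 1 ≤ b) (hX : (Fintype.card X : ℝ) ≤ b ^ t) {ρ : ℝ} (hρ : 0 ≤ ρ)
    {Q : ℕ} (hQ : (Fintype.card X : ℝ) < Real.exp (Q / b)) :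
    ∃ κ : Fin Q → X → ℕ,
      (∀ p i, κ p i < Fintype.card X) ∧
      (∀ p i j, κ p i = κ p j → dist i j ≤ (4 * t - 2) * ρ) ∧
      ∀ i, ∃ p, ∀ j, dist i j ≤ ρ → κ p i = κ p j := by
  classical
  have hb0 : 0 < b := by linarith
  have hq : 0 ≤ 1 - 1 / b := sub_nonneg.mpr ((div_le_one hb0).mpr hb)
  -- `U` holds the points not yet padded by any partition; each new partition pads a `1 / b`
  -- fraction of it. Eventually fewer than `n * exp (-Q / b) < 1` points could remain, so none do.
  have key : ∀ Q : ℕ, ∃ (κ : Fin Q → X → ℕ) (U : Finset X),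
      (∀ p i, κ p i < Fintype.card X) ∧
      (∀ p i j, κ p i = κ p j → dist i j ≤ (4 * t - 2) * ρ) ∧
      (∀ i ∉ U, ∃ p, ∀ j, dist i j ≤ ρ → κ p i = κ p j) ∧
      (U.card : ℝ) ≤ Fintype.card X * (1 - 1 / b) ^ Q := by
    intro Q
    induction Q with
    | zero => exact ⟨fun p => p.elim0, Finset.univ, fun p => p.elim0, fun p => p.elim0,
        by simp, by simp⟩
    | succ Q ih =>
      obtain ⟨κ, U, h1, h2, h3, h4⟩ := ih
      obtain ⟨μ, V, hμ, hVU, hc, hpad⟩ := exists_padded_labelling ht hb0.le hX hρ U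
      obtain ⟨ν, hν, hνμ⟩ := exists_labelling_lt_card μ
      refine ⟨Fin.cons ν κ, U \ V, ?_, ?_, ?_, ?_⟩
      · exact fun p => Fin.cases hν h1 p
      · exact fun p => Fin.cases (fun i j h => hμ i j ((hνμ i j).mp h)) h2 p
      · intro i hi
        by_cases hV : i ∈ V
        · exact ⟨0, fun j hj => (hνμ i j).mpr (hpad i hV j hj)⟩
        · obtain ⟨p, hp⟩ := h3 i fun hU => hi (Finset.mem_sdiff.mpr ⟨hU, hV⟩)
          exact ⟨p.succ, hp⟩
      · have e : ((U \ V).card : ℝ) = U.card - V.card := by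
          rw [Finset.card_sdiff_of_subset hVU, Nat.cast_sub (Finset.card_le_card hVU)]
        have hV : (U.card : ℝ) / b ≤ V.card := (div_le_iff₀' hb0).mpr hc
        calc ((U \ V).card : ℝ) ≤ U.card * (1 - 1 / b) := by rw [e]; ring_nf at hV ⊢; linarith
          _ ≤ Fintype.card X * (1 - 1 / b) ^ Q * (1 - 1 / b) := by gcongr
          _ = _ := by ring
  obtain ⟨κ, U, h1, h2, h3, h4⟩ := key Q
  refine ⟨κ, h1, h2, fun i => h3 i fun hi => ?_⟩
  have hU : (1 : ℝ) ≤ U.card := by exact_mod_cast Finset.card_pos.mpr ⟨i, hi⟩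
  have hexp : (1 - 1 / b) ^ Q ≤ Real.exp (-(Q / b)) := by
    have : (1 - 1 / b) ≤ Real.exp (-(1 / b)) := by
      have := Real.add_one_le_exp (-(1 / b)); linarith
    calc (1 - 1 / b) ^ Q ≤ Real.exp (-(1 / b)) ^ Q := by gcongr
      _ = _ := by rw [← Real.exp_nat_mul]; congr 1; ring
  have : (Fintype.card X : ℝ) * Real.exp (-(Q / b)) < 1 := by
    rw [Real.exp_neg, ← div_eq_mul_inv, div_lt_one (Real.exp_pos _)]
    exact hQ
  have := mul_le_mul_of_nonneg_left hexp (Nat.cast_nonneg (Fintype.card X) : (0 : ℝ) ≤ _)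
  linarith

/-! ### Testing whether the support lies in one cluster -/

/-- The equality case of the Cauchy-Schwarz inequality for the moments of a labelling `κ` with
nonnegative weights `y`. -/
theorem moments_eq_iff {X : Type*} [Fintype X] (y κ : X → ℕ) :
    (∑ i, y i * κ i ^ 0) * (∑ i, y i * κ i ^ 2) = (∑ i, y i * κ i ^ 1) ^ 2 ↔
      ∀ i j, 0 < y i → 0 < y j → κ i = κ j := by
  -- Lagrange's identity: the Cauchy-Schwarz defect is a sum of nonnegative terms, so it vanishes
  -- only if each term does.
  have key : ∑ i, ∑ j, (y i : ℤ) * y j * ((κ i : ℤ) - κ j) ^ 2 =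
      2 * ((∑ i, (y i : ℤ) * κ i ^ 0) * (∑ i, (y i : ℤ) * κ i ^ 2)
        - (∑ i, (y i : ℤ) * κ i ^ 1) ^ 2) := by
    have h1 := Finset.sum_mul_sum Finset.univ Finset.univ
      (fun i => (y i : ℤ) * κ i ^ 0) (fun i => (y i : ℤ) * κ i ^ 2)
    have h2 := Finset.sum_mul_sum Finset.univ Finset.univ
      (fun i => (y i : ℤ) * κ i ^ 2) (fun i => (y i : ℤ) * κ i ^ 0)
    have h3 := Finset.sum_mul_sum Finset.univ Finset.univ
      (fun i => (y i : ℤ) * κ i ^ 1) (fun i => (y i : ℤ) * κ i ^ 1)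
    have h4 : ∀ a b c : ℤ, a * b = b * a → 2 * (a * b - c ^ 2) = a * b + b * a - 2 * (c * c) := by
      intro a b c _; ring
    rw [h4 _ _ _ (mul_comm _ _), h1, h2, h3, Finset.mul_sum, ← Finset.sum_add_distrib,
      ← Finset.sum_sub_distrib]
    refine Finset.sum_congr rfl fun i _ => ?_
    rw [Finset.mul_sum, ← Finset.sum_add_distrib, ← Finset.sum_sub_distrib]
    exact Finset.sum_congr rfl fun j _ => by ring
  have hnn : ∀ i j, 0 ≤ (y i : ℤ) * y j * ((κ i : ℤ) - κ j) ^ 2 := fun i j => by positivity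
  have hzero : (∑ i, y i * κ i ^ 0) * (∑ i, y i * κ i ^ 2) = (∑ i, y i * κ i ^ 1) ^ 2 ↔
      ∑ i, ∑ j, (y i : ℤ) * y j * ((κ i : ℤ) - κ j) ^ 2 = 0 := by
    rw [key, mul_eq_zero, sub_eq_zero]
    simp only [OfNat.ofNat_ne_zero, false_or]
    exact_mod_cast Iff.rfl
  rw [hzero, Finset.sum_eq_zero_iff_of_nonneg fun i _ => Finset.sum_nonneg fun j _ => hnn i j]
  refine forall_congr' fun i => ?_
  simp only [Finset.mem_univ, true_imp_iff]
  rw [Finset.sum_eq_zero_iff_of_nonneg fun j _ => hnn i j]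
  refine forall_congr' fun j => ?_
  simp only [Finset.mem_univ, true_imp_iff, mul_eq_zero, Nat.cast_eq_zero, pow_eq_zero_iff,
    sub_eq_zero, Nat.cast_inj, ne_eq, OfNat.ofNat_ne_zero, not_false_eq_true, Nat.pos_iff_ne_zero]
  tauto

/-! ### The sketch -/

/-- The linear sketch that stores, for each labelling `κ p`, the moments `∑ i, x i * κ p i ^ e`,
`e = 0, 1, 2`, modulo `N`. -/
def momentSketch {X ι : Type} [Fintype X] (κ : ι → X → ℕ) (N : ℕ) : (X → ℤ) →+ (ι × Fin 3 → ZMod N) where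
  toFun x p := ((∑ i, x i * (κ p.1 i : ℤ) ^ (p.2 : ℕ) : ℤ) : ZMod N)
  map_zero' := by ext; simp
  map_add' x y := by ext; simp [add_mul, Finset.sum_add_distrib]

/-- The test, on the sketch, whether the support lies in one fibre of the labelling `p`. -/
def InOneCluster {ι : Type} {N : ℕ} (m : ι × Fin 3 → ZMod N) (p : ι) : Prop :=
  (m (p, 0)).val * (m (p, 2)).val = (m (p, 1)).val ^ 2

/-- For labels below n and weights in [0, m] every moment is at most n · m · n² < N, so the residues
are the true moments and the equality case of Cauchy-Schwarz applies. -/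
theorem inOneCluster_momentSketch_iff {X ι : Type} [Fintype X] {κ : ι → X → ℕ} {N m : ℕ} {p : ι}
    (hκ : ∀ i, κ p i < Fintype.card X) (hN : Fintype.card X * (m * Fintype.card X ^ 2) < N)
    {x : X → ℤ} (hx : ∀ i, 0 ≤ x i ∧ x i ≤ m) :
    InOneCluster (momentSketch κ N x) p ↔ ∀ i j, 0 < x i → 0 < x j → κ p i = κ p j := by
  have hy : ∀ i, ((x i).toNat : ℤ) = x i := fun i => Int.toNat_of_nonneg (hx i).1
  have hval : ∀ e : Fin 3, (momentSketch κ N x (p, e)).val =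
      ∑ i, (x i).toNat * κ p i ^ (e : ℕ) := by
    intro e
    have h1 : momentSketch κ N x (p, e) =
        ((∑ i, (x i).toNat * κ p i ^ (e : ℕ) : ℕ) : ZMod N) := by
      change ((∑ i, x i * (κ p i : ℤ) ^ (e : ℕ) : ℤ) : ZMod N) = _
      rw [← Int.cast_natCast]
      push_cast [hy]
      rfl
    rw [h1, ZMod.val_natCast, Nat.mod_eq_of_lt]
    refine lt_of_le_of_lt (Finset.sum_le_card_nsmul _ _ (m * Fintype.card X ^ 2) ?_) hN
    intro i _
    have h2 : (x i).toNat ≤ m := by have := (hx i).2; omega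
    have h3 : κ p i ^ (e : ℕ) ≤ Fintype.card X ^ 2 :=
      (Nat.pow_le_pow_left (hκ i).le _).trans
        (Nat.pow_le_pow_right (Fintype.card_pos_iff.mpr ⟨i⟩) (by omega))
    exact Nat.mul_le_mul h2 h3
  rw [InOneCluster, hval, hval, hval]
  refine (moments_eq_iff (fun i => (x i).toNat) (κ p)).trans ?_
  simp only [Int.lt_toNat, Nat.cast_zero]

/-- Additivity is what allows arbitrary intermediate frequency vectors. -/
theorem foldl_add_eq {X : Type} [DecidableEq X] {G : Type} [AddCommGroup G] (φ : (X → ℤ) →+ G) (g : G)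
    (σ : List (Update X)) : σ.foldl (fun m a => m + φ a.vec) g = g + φ (freq σ) := by
  induction σ generalizing g with
  | nil => simp [freq]
  | cons a σ ih =>
    rw [List.foldl_cons, ih]
    simp [freq, add_assoc]

/-! ### From scales to the diameter -/

open Classical in
/-- The estimate obtained from the tests `T s` at the geometric scales `ρ * q ^ s`: the scale that
precedes the first one that passes, and zero if the scale `0` passes. -/
noncomputable def scaleEstimate (T : ℕ → Prop) (ρ q : ℝ) : ℝ :=
  if T 0 then 0 else if h : ∃ s, T (s + 1) then ρ * q ^ Nat.find h else 0

/-- If scale `s` fails and `s + 1` passes, then `ρ q^s < d ≤ τ q · ρ q^s < c · ρ q^s`. No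
monotonicity of the tests is required. -/
theorem isApprox_scaleEstimate {T : ℕ → Prop} {ρ q τ c d : ℝ} {S : ℕ} (hρ : 0 < ρ) (hq : 0 < q)
    (hτ : 0 ≤ τ) (hc : τ * q < c) (hT : ∀ s, T s → d ≤ τ * (ρ * q ^ s))
    (hT' : ∀ s ≤ S, d ≤ ρ * q ^ s → T s) (hS : d ≤ ρ * q ^ S) (h0 : d ≤ τ * ρ → d = 0) :
    IsApprox c d (scaleEstimate T ρ q) := by
  have hc0 : 0 < c := (mul_nonneg hτ hq.le).trans_lt hc
  by_cases hT0 : T 0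
  · right
    refine ⟨h0 (by simpa using hT 0 hT0), by simp [scaleEstimate, hT0]⟩
  · left
    have hTS := hT' S le_rfl hS
    have hS0 : S ≠ 0 := by rintro rfl; exact hT0 hTS
    obtain ⟨S, rfl⟩ := Nat.exists_eq_succ_of_ne_zero hS0
    have h : ∃ s, T (s + 1) := ⟨S, hTS⟩
    rw [scaleEstimate, if_neg hT0, dif_pos h]
    classical
    obtain ⟨s, hs⟩ : ∃ s, s = Nat.find h := ⟨_, rfl⟩
    have hs1 : T (s + 1) := hs ▸ Nat.find_spec h
    have hsS : s ≤ S := hs ▸ Nat.find_min' h hTS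
    have hs2 : ¬ T s := by
      cases s with
      | zero => exact hT0
      | succ s => exact Nat.find_min h (by omega)
    have hlt : ρ * q ^ s < d := by
      by_contra! hle
      exact hs2 (hT' s (by omega) hle)
    have hpos : 0 < ρ * q ^ s := by positivity
    have hfin : d / c < ρ * q ^ s ∧ ρ * q ^ s ≤ d := by
      refine ⟨?_, hlt.le⟩
      rw [div_lt_iff₀ hc0]
      calc d ≤ τ * (ρ * q ^ (s + 1)) := hT _ hs1
        _ = (ρ * q ^ s) * (τ * q) := by ring
        _ < _ := mul_lt_mul_of_pos_left hc hpos
    convert hfin <;> exact hs.symm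

theorem diam_nonneg {X : Type} [MetricSpace X] (x : X → ℤ) : 0 ≤ diam x := Metric.diam_nonneg

theorem dist_le_diam {X : Type} [Finite X] [MetricSpace X] {x : X → ℤ} {i j : X} (hi : 0 < x i)
    (hj : 0 < x j) : dist i j ≤ diam x :=
  Metric.dist_le_diam_of_mem (Set.toFinite _).isBounded hi hj

theorem diam_le {X : Type} [MetricSpace X] {x : X → ℤ} {C : ℝ} (hC : 0 ≤ C)
    (h : ∀ i j, 0 < x i → 0 < x j → dist i j ≤ C) : diam x ≤ C :=
  Metric.diam_le_of_forall_dist_le hC fun i hi j hj => h i j hi hj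

/-- The deterministic diameter algorithm, in terms of its parameters: the sparse cover parameters
`t` and `b`, the number `Q` of partitions per scale, the number `S` of scales, and the modulus `N`
of the counters. -/
theorem exists_diam_algorithm {X : Type} [Fintype X] [DecidableEq X] [Nonempty X]
    [MetricSpace X]
    {t : ℕ} (ht : 1 ≤ t) {b : ℝ} (hb : 1 ≤ b) (hX : (Fintype.card X : ℝ) ≤ b ^ t)
    {Q : ℕ} (hQ : (Fintype.card X : ℝ) < Real.exp (Q / b))
    {δ R q c : ℝ} (hδ : 0 < δ) (hδ' : ∀ i j : X, i ≠ j → δ ≤ dist i j)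
    (hR0 : 0 ≤ R) (hR : ∀ i j : X, dist i j ≤ R) (hq : 1 ≤ q) (hc : (4 * t - 2) * q < c)
    {S : ℕ} (hS : R ≤ δ / (4 * t) * q ^ S)
    {N m : ℕ} (hN : Fintype.card X * (m * Fintype.card X ^ 2) < N) :
    ∃ 𝒜 : StreamingAlgorithm X,
      (∀ σ : List (Update X), (∀ i, 0 ≤ freq σ i ∧ freq σ i ≤ m) →
        𝒜.outputProb σ (IsApprox c (diam (freq σ))) = 1) ∧
      ∀ m', 𝒜.SpaceLE m' (Real.logb 2 ((N : ℝ) ^ ((S + 1) * Q * 3) + 1)) := by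
  classical
  have ht' : (1 : ℝ) ≤ t := by exact_mod_cast ht
  have hq0 : 0 < q := by linarith
  have hρ : 0 < δ / (4 * t) := by positivity
  -- The base scale `δ / (4t)` is so small that clusters there have diameter below the minimum
  -- distance `δ`: passing scale 0 forces diameter zero.
  choose κ hκ hκd hκp using fun s : ℕ =>
    exists_sparse_cover (X := X) ht hb hX (ρ := δ / (4 * t) * q ^ s) (by positivity) hQ
  have : NeZero N := ⟨by omega⟩
  let ι := Fin (S + 1) × Fin Q
  let κ' : ι → X → ℕ := fun p => κ p.1 p.2
  let φ := momentSketch κ' N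
  let T : (ι × Fin 3 → ZMod N) → ℕ → Prop := fun g s =>
    ∃ (h : s < S + 1) (p : Fin Q), InOneCluster g (⟨s, h⟩, p)
  obtain ⟨𝒜, h𝒜, hspace⟩ := exists_streamingAlgorithm_of_automaton (X := X)
    (0 : ι × Fin 3 → ZMod N) (fun g a => g + φ a.vec) (fun g => scaleEstimate (T g) (δ / (4 * t)) q)
  refine ⟨𝒜, fun σ hσ => h𝒜 σ _ ?_, fun m' => ?_⟩
  · rw [foldl_add_eq, zero_add]
    set x := freq σ
    have htest : ∀ s (h : s < S + 1) p, InOneCluster (φ x) (⟨s, h⟩, p) ↔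
        ∀ i j, 0 < x i → 0 < x j → κ s p i = κ s p j := fun s h p =>
      inOneCluster_momentSketch_iff (κ := κ') (p := (⟨s, h⟩, p)) (hκ s p) hN hσ
    have hτ : (0 : ℝ) ≤ 4 * t - 2 := by linarith
    refine isApprox_scaleEstimate (S := S) hρ hq0 hτ hc ?_ ?_ ?_ ?_
    · rintro s ⟨h, p, hp⟩
      exact diam_le (by positivity) fun i j hi hj => hκd s p i j ((htest s h p).mp hp i j hi hj)
    · intro s hs hd
      -- The ball around any support point contains the whole support. With empty support every
      -- partition passes, and it only remains to see that one exists.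
      by_cases hne : ∃ i, 0 < x i
      · obtain ⟨i, hi⟩ := hne
        obtain ⟨p, hp⟩ := hκp s i
        refine ⟨by omega, p, (htest s _ p).mpr fun j k hj hk => ?_⟩
        rw [← hp j ((dist_le_diam hi hj).trans hd), ← hp k ((dist_le_diam hi hk).trans hd)]
      · push Not at hne
        have hQ0 : 0 < Q := by
          rcases Nat.eq_zero_or_pos Q with rfl | h
          · simp at hQ
          · exact h
        exact ⟨by omega, ⟨0, hQ0⟩, (htest s _ _).mpr fun j k hj => absurd hj (hne j).not_gt⟩
    · exact (diam_le hR0 fun i j _ _ => hR i j).trans hS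
    · intro hle
      have hlt : (4 * t - 2) * (δ / (4 * t)) < δ := by
        rw [mul_div_assoc', div_lt_iff₀ (by positivity)]
        nlinarith
      refine le_antisymm (diam_le le_rfl fun i j hi hj => ?_) (diam_nonneg x)
      by_contra! hij
      have hne : i ≠ j := dist_pos.mp hij
      linarith [hδ' i j hne, dist_le_diam hi hj]
  · convert hspace m' using 4
    rw [Fintype.card_fun, Fintype.card_prod, Fintype.card_prod, ZMod.card]
    simp

end DynStream

/-! ### Choice of parameters and the count of bits. -/

/-- The algorithm is deterministic: for nonnegative frequency vectors the test whether the support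
lies in one cluster of a partition needs no randomness. -/
theorem theorem2 (A B D : ℕ) :
    ∃ (C : ℝ) (k : ℕ),
      ∀ (X : Type) [Fintype X] [DecidableEq X] [MetricSpace X] (n : ℕ),
        Fintype.card X = n → 2 ≤ n →
        DynStream.AspectRatioLE X ((n : ℝ) ^ A) →
        ∀ c : ℝ, 6 < c →
          ∃ 𝒜 : DynStream.StreamingAlgorithm X,
            (∀ σ : List (DynStream.Update X),
              (∀ i, 0 ≤ DynStream.freq σ i ∧ DynStream.freq σ i ≤ (n : ℤ) ^ B) →
                1 - 1 / (n : ℝ) ^ D ≤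
                  𝒜.outputProb σ (DynStream.IsApprox c (DynStream.diam (DynStream.freq σ)))) ∧
            𝒜.SpaceLE (n ^ B)
              (C * (n : ℝ) ^ (1 / (⌊(c - 2) / 4⌋₊ : ℝ)) * Real.log n ^ k) := by
  -- Here 162 = 2 · 3⁴, from `b ≤ 2 n^{1/T}` and `L ≤ 3 log n`. Of the four logarithms, one is the
  -- counter length, two bound the number of scales, and one comes from the partitions per scale.
  refine ⟨162 * (6 * (2 * A + 4) * (B + 3) + 1), 4, ?_⟩
  intro X _ _ _ n hn hn2 hasp c hc
  have hn2' : (2 : ℝ) ≤ n := by exact_mod_cast hn2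
  have hn0 : (0 : ℝ) < n := by linarith
  -- the logarithm of the number of points, and the cover parameter
  set L := Nat.log 2 n + 1 with hL
  have hL1 : (1 : ℝ) ≤ L := by exact_mod_cast Nat.le_add_left 1 _
  have hnL : n < 2 ^ L := Nat.lt_pow_succ_log_self one_lt_two n
  have hnL' : (n : ℝ) < 2 ^ L := by exact_mod_cast hnL
  have hLlog : (L : ℝ) ≤ 3 * Real.log n := by
    have h1 : ((2 : ℝ) ^ Nat.log 2 n) ≤ n := by
      exact_mod_cast Nat.pow_log_le_self 2 (by omega : n ≠ 0)
    have h2 : (Nat.log 2 n : ℝ) * Real.log 2 ≤ Real.log n := by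
      rw [← Real.log_pow]; exact Real.log_le_log (by positivity) h1
    have h3 : Real.log 2 ≤ Real.log n := Real.log_le_log two_pos hn2'
    have h4 := Real.log_two_gt_d9
    rw [hL]; push_cast
    have h5 : (0 : ℝ) ≤ Nat.log 2 n := Nat.cast_nonneg _
    nlinarith
  set T := ⌊(c - 2) / 4⌋₊ with hT
  have hT1 : 1 ≤ T := Nat.le_floor (by push_cast; linarith)
  have hTc : (T : ℝ) ≤ (c - 2) / 4 := Nat.floor_le (by linarith)
  -- Capping at `L` keeps the number of scales polylogarithmic for huge `c`; it costs at most a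
  -- factor 2, because `n^{1/L} ≤ 2`.
  set t := min T L with ht
  have ht1 : 1 ≤ t := le_min hT1 (by omega)
  have ht1' : (1 : ℝ) ≤ t := by exact_mod_cast ht1
  have ht0 : (0 : ℝ) < t := by linarith
  have htT : (t : ℝ) ≤ T := by exact_mod_cast min_le_left _ _
  have htL : (t : ℝ) ≤ L := by exact_mod_cast min_le_right _ _
  set b := (n : ℝ) ^ (1 / (t : ℝ)) with hb
  have hb1 : 1 ≤ b := Real.one_le_rpow (by linarith) (by positivity)
  have hbt : b ^ t = n := by
    rw [hb, ← Real.rpow_natCast, ← Real.rpow_mul hn0.le, one_div_mul_cancel ht0.ne', Real.rpow_one]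
  have hbT : b ≤ 2 * (n : ℝ) ^ (1 / (T : ℝ)) := by
    have h1 : (1 : ℝ) ≤ (n : ℝ) ^ (1 / (T : ℝ)) := Real.one_le_rpow (by linarith) (by positivity)
    rcases le_total T L with h | h
    · rw [hb, ht, min_eq_left h]; linarith
    · have h2 : b ≤ 2 := by
        have h3 : b ^ t ≤ 2 ^ t := by
          rw [hbt, ht, min_eq_right h]; exact hnL'.le
        exact le_of_pow_le_pow_left₀ (by omega) zero_le_two h3
      linarith
  -- the number of partitions per scale
  have hQ : (Fintype.card X : ℝ) < Real.exp ((⌈b * L⌉₊ : ℝ) / b) := by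
    have h1 : (L : ℝ) ≤ (⌈b * L⌉₊ : ℝ) / b := by
      rw [le_div_iff₀' (by linarith)]; exact Nat.le_ceil _
    rw [hn]
    calc (n : ℝ) < 2 ^ L := hnL'
      _ ≤ Real.exp 1 ^ L := by
        gcongr; linarith [Real.add_one_le_exp (1 : ℝ)]
      _ = Real.exp L := by rw [← Real.exp_nat_mul, mul_one]
      _ ≤ _ := Real.exp_le_exp.mpr h1
  have hQle : (⌈b * L⌉₊ : ℝ) ≤ 2 * (b * L) := by
    have h1 := (Nat.ceil_lt_add_one (by positivity : 0 ≤ b * L)).le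
    nlinarith
  -- the range of distances
  obtain ⟨u, v, huv⟩ := Fintype.one_lt_card_iff.mp (by omega : 1 < Fintype.card X)
  have hd0 : 0 < dist u v := dist_pos.mpr huv
  have hnA : (0 : ℝ) < (n : ℝ) ^ A := by positivity
  have hlow : ∀ i j : X, i ≠ j → dist u v / (n : ℝ) ^ A ≤ dist i j := fun i j hij =>
    (div_le_iff₀' hnA).mpr (hasp u v i j huv hij)
  have hup : ∀ i j : X, dist i j ≤ (n : ℝ) ^ A * dist u v := by
    intro i j
    rcases eq_or_ne i j with rfl | hij
    · rw [dist_self]; positivity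
    · exact hasp i j u v hij huv
  -- the number of scales
  have hq : (4 * (t : ℝ) - 2) * (1 + 1 / t) < c := by
    have h1 : (4 * (t : ℝ) - 2) * (1 + 1 / t) = 4 * t + 2 - 2 / t := by field_simp; ring
    have h2 : 0 < 2 / (t : ℝ) := by positivity
    rw [h1]; linarith
  -- By Bernoulli, `t` scales at least double the radius; 2 doublings pay for the 4, `L` for `t`,
  -- and `2AL` for `n^{2A}`.
  have hS : (n : ℝ) ^ A * dist u v ≤ dist u v / (n : ℝ) ^ A / (4 * t) *
      (1 + 1 / (t : ℝ)) ^ (t * (2 + L + 2 * A * L)) := by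
    have h1 : (2 : ℝ) ≤ (1 + 1 / (t : ℝ)) ^ t := by
      have := one_add_mul_le_pow (a := 1 / (t : ℝ)) (by linarith [one_div_pos.mpr ht0]) t
      rw [mul_one_div_cancel ht0.ne'] at this
      linarith
    have h2 : (t : ℝ) ≤ 2 ^ L := htL.trans (by exact_mod_cast Nat.lt_two_pow_self.le)
    have h3 : 4 * t * ((n : ℝ) ^ A * (n : ℝ) ^ A) ≤
        (1 + 1 / (t : ℝ)) ^ (t * (2 + L + 2 * A * L)) := by
      rw [pow_mul]
      calc 4 * t * ((n : ℝ) ^ A * (n : ℝ) ^ A)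
          ≤ 4 * 2 ^ L * ((2 ^ L) ^ A * (2 ^ L) ^ A) := by gcongr
        _ = 2 ^ (2 + L + 2 * A * L) := by ring
        _ ≤ _ := by gcongr
    calc (n : ℝ) ^ A * dist u v = dist u v / (n : ℝ) ^ A / (4 * t) *
          (4 * t * ((n : ℝ) ^ A * (n : ℝ) ^ A)) := by field_simp
      _ ≤ _ := by gcongr
  have hN : Fintype.card X * (n ^ B * Fintype.card X ^ 2) < 2 ^ (L * (B + 3)) := by
    rw [hn, pow_mul]
    calc n * (n ^ B * n ^ 2) = n ^ (B + 3) := by ring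
      _ < _ := Nat.pow_lt_pow_left hnL (by omega)
  have : Nonempty X := ⟨u⟩
  obtain ⟨𝒜, h𝒜, hspace⟩ := DynStream.exists_diam_algorithm ht1 hb1 (by rw [hn, hbt]) hQ
    (div_pos hd0 hnA) hlow (by positivity) hup (by linarith [one_div_pos.mpr ht0]) hq hS hN
  refine ⟨𝒜, fun σ hσ => ?_, ?_⟩
  · rw [h𝒜 σ (by exact_mod_cast hσ)]
    linarith [show (0 : ℝ) ≤ 1 / (n : ℝ) ^ D by positivity]
  · refine ⟨(hspace _).1, (hspace _).2.trans ?_⟩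
    -- `E` is the number of counters: scales, times partitions, times three moments.
    set E := (t * (2 + L + 2 * A * L) + 1) * ⌈b * L⌉₊ * 3 with hE
    have h1 : (((2 ^ (L * (B + 3)) : ℕ) : ℝ) ^ E + 1) ≤ 2 ^ (L * (B + 3) * E + 1) := by
      have : (1 : ℝ) ≤ 2 ^ (L * (B + 3) * E) := one_le_pow₀ one_le_two
      push_cast
      rw [← pow_mul, pow_succ]
      linarith
    have h2 : Real.logb 2 (((2 ^ (L * (B + 3)) : ℕ) : ℝ) ^ E + 1) ≤ L * (B + 3) * E + 1 := by
      refine (Real.logb_le_logb_of_le one_lt_two (by positivity) h1).trans_eq ?_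
      rw [Real.logb_pow, Real.logb_self_eq_one one_lt_two, mul_one]
      push_cast; ring
    have h3 : (t : ℝ) * (2 + L + 2 * A * L) + 1 ≤ (2 * A + 4) * L ^ 2 := by
      have h4 : (2 : ℝ) + L + 2 * A * L ≤ (2 * A + 3) * L := by linarith
      have h5 : (t : ℝ) * (2 + L + 2 * A * L) ≤ L * ((2 * A + 3) * L) := by gcongr
      nlinarith
    have h6 : (E : ℝ) ≤ (2 * A + 4) * L ^ 2 * (2 * (b * L)) * 3 := by
      rw [hE]; push_cast; gcongr
    have h7 : (1 : ℝ) ≤ b * L ^ 4 := one_le_mul_of_one_le_of_one_le hb1 (one_le_pow₀ hL1)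
    calc Real.logb 2 (((2 ^ (L * (B + 3)) : ℕ) : ℝ) ^ E + 1) ≤ L * (B + 3) * E + 1 := h2
      _ ≤ L * (B + 3) * ((2 * A + 4) * L ^ 2 * (2 * (b * L)) * 3) + b * L ^ 4 := by gcongr
      _ = (6 * (2 * A + 4) * (B + 3) + 1) * b * L ^ 4 := by ring
      _ ≤ (6 * (2 * A + 4) * (B + 3) + 1) * (2 * (n : ℝ) ^ (1 / (T : ℝ))) *
          (3 * Real.log n) ^ 4 := by gcongr
      _ = _ := by ring
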